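/- An $n$-bit gate is a unitary operator on $(\mathbb C^2)^{\otimes n}$, whose standard orthonormal basis consists of the vectors $|x_1x_2\cdots x_n\rangle$, $x_i\in\{0,1\}$. For a 1-bit gate $A$ and a slot $j$, let $A(j)$ be the $n$-bit gate acting as $A$ on the $j$-th qubit and trivially on the others; for a 2-bit gate $B$ and two distinct slots $j,k$, let $B(j,k)$ be the $n$-bit gate acting as $B$ on the $j$-th and $k$-th qubits (in this order) and trivially on the others. A collection of 1-bit gates $A_i$ and 2-bit gates $B_j$ is called (exactly) universal if, for each $n\ge 2$, every $n$-bit gate is equal, up to a global phase factor $c\in\mathbb C$, $|c|=1$, to a finite composition of gates $A_i(\ell)$ and $B_j(\ell,m)$ with $1\le \ell,m\le n$, $\ell\ne m$. Let $$U_{\theta,\phi}=\begin{pmatrix}\cos\theta & -ie^{-i\phi}\sin\theta\\ -ie^{i\phi}\sin\theta & \cos\theta\end{pmatrix},$$ and let the CNOT gate $\Lambda_1(\sigma_x)$ be the 2-bit gate with $|0y\rangle\mapsto|0y\rangle$ and $|1y\rangle\mapsto|1\rangle\otimes\sigma_x|y\rangle$, where $\sigma_x=\begin{pmatrix}0&1\\1&0\end{pmatrix}$.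 **Corollary 2.3.** The collection of all the 1-bit gates $U_{\theta,\phi}$, $0\le\theta,\phi\le 2\pi$, together with the CNOT gate $\Lambda_1(\sigma_x)$, is universal. Moreover, for each $n\ge 2$, every $n$-bit gate of determinant $1$ is equal to such a finite composition with no phase factor. -/

import Mathlib

/-- A 1-bit gate: a unitary operator on one qubit, written in the basis `|0⟩, |1⟩`. -/
abbrev OneBitGate : Type := Matrix.unitaryGroup (Fin 2) ℂ

/-- A 2-bit gate: a unitary operator on two qubits, written in the basis `|x₁x₂⟩`. -/
abbrev TwoBitGate : Type := Matrix.unitaryGroup (Fin 2 × Fin 2) ℂ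

/-- An operator on `n` qubits, written in the basis `|x₁x₂⋯xₙ⟩` of `(ℂ²)^{⊗n}`, which is indexed by
the bit strings `x : Fin n → Fin 2`. Slots are numbered `0, …, n - 1`. -/
abbrev QubitOperator (n : ℕ) : Type := Matrix (Fin n → Fin 2) (Fin n → Fin 2) ℂ

/-- `A(j)`: the 1-bit gate `A` acting on slot `j` of `n` qubits, and trivially on the others. -/
def OneBitGate.onSlot {n : ℕ} (A : OneBitGate) (j : Fin n) : QubitOperator n :=
  Matrix.of fun x y =>
    if ∀ i, i ≠ j → x i = y i then (A : Matrix (Fin 2) (Fin 2) ℂ) (x j) (y j) else 0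

/-- `B(j,k)`: the 2-bit gate `B` acting on the (distinct) slots `j` and `k` of `n` qubits, with `j`
as its first qubit and `k` as its second one, and trivially on the others. -/
def TwoBitGate.onSlots {n : ℕ} (B : TwoBitGate) (j k : Fin n) : QubitOperator n :=
  Matrix.of fun x y =>
    if ∀ i, i ≠ j → i ≠ k → x i = y i then
      (B : Matrix (Fin 2 × Fin 2) (Fin 2 × Fin 2) ℂ) (x j, x k) (y j, y k) else 0

/-- The operators `A(j)` and `B(j,k)` on `n` qubits, for `A` in the collection `S` of 1-bit gates,
`B` in the collection `T` of 2-bit gates, and all slots `j` and all pairs of distinct slots. -/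
def elementaryOperators (S : Set OneBitGate) (T : Set TwoBitGate) (n : ℕ) :
    Set (QubitOperator n) :=
  {M | (∃ A ∈ S, ∃ j : Fin n, M = A.onSlot j) ∨
       (∃ B ∈ T, ∃ j k : Fin n, j ≠ k ∧ M = TwoBitGate.onSlots B j k)}

/-- The operators on `n` qubits obtained by composing finitely many elementary ones. -/
def composedOperators (S : Set OneBitGate) (T : Set TwoBitGate) (n : ℕ) :
    Submonoid (QubitOperator n) :=
  Submonoid.closure (elementaryOperators S T n)

/-- Exact universality of a collection of 1-bit gates `S` and 2-bit gates `T`: for each `n ≥ 2`,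
every `n`-bit gate equals, up to a global phase factor, a finite composition of gates `A(j)` and
`B(j,k)`. -/
def IsUniversalGateSet (S : Set OneBitGate) (T : Set TwoBitGate) : Prop :=
  ∀ n : ℕ, 2 ≤ n → ∀ V ∈ Matrix.unitaryGroup (Fin n → Fin 2) ℂ,
    ∃ c : ℂ, ‖c‖ = 1 ∧ c • V ∈ composedOperators S T n

/-- The matrix of the rotation gate `U_{θ,φ}`. -/
noncomputable def rotationMatrix (θ φ : ℝ) : Matrix (Fin 2) (Fin 2) ℂ :=
  !![(Real.cos θ : ℂ), -Complex.I * Complex.exp (-Complex.I * φ) * (Real.sin θ : ℂ);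
     -Complex.I * Complex.exp (Complex.I * φ) * (Real.sin θ : ℂ), (Real.cos θ : ℂ)]

theorem rotationMatrix_mem (θ φ : ℝ) :
    rotationMatrix θ φ ∈ Matrix.unitaryGroup (Fin 2) ℂ := by
  have h1 : Complex.exp (Complex.I * φ) * Complex.exp (-(Complex.I * φ)) = 1 := by
    rw [← Complex.exp_add]; simp
  have h2 : Complex.cos θ ^ 2 + Complex.sin θ ^ 2 = 1 := Complex.cos_sq_add_sin_sq _
  have h3 : (starRingEnd ℂ) (Complex.exp (Complex.I * φ)) = Complex.exp (-(Complex.I * φ)) := by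
    rw [← Complex.exp_conj]; simp
  have h4 : (starRingEnd ℂ) (Complex.exp (-(Complex.I * φ))) = Complex.exp (Complex.I * φ) := by
    rw [← Complex.exp_conj]; simp
  have hc : (starRingEnd ℂ) (Complex.cos θ) = Complex.cos θ := by
    rw [← Complex.cos_conj]; simp
  have hs : (starRingEnd ℂ) (Complex.sin θ) = Complex.sin θ := by
    rw [← Complex.sin_conj]; simp
  rw [Matrix.mem_unitaryGroup_iff]
  ext i j
  fin_cases i <;> fin_cases j <;>
    simp [rotationMatrix, Matrix.mul_apply, Fin.sum_univ_two, h3, h4, hc, hs] <;>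
    grind [Complex.I_sq]

/-- The rotation gate `U_{θ,φ}`. -/
noncomputable def rotationGate (θ φ : ℝ) : OneBitGate := ⟨rotationMatrix θ φ, rotationMatrix_mem θ φ⟩

/-- The NOT gate `σ_x`. -/
def pauliX : Matrix (Fin 2) (Fin 2) ℂ := !![0, 1; 1, 0]

/-- The matrix of `Λ₁(U)`, the controlled-`U` operation: `|0y⟩ ↦ |0y⟩` and
`|1y⟩ ↦ u_{0y}|10⟩ + u_{1y}|11⟩`. The first qubit is the control, the second the target. -/
def controlledMatrix (U : Matrix (Fin 2) (Fin 2) ℂ) :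
    Matrix (Fin 2 × Fin 2) (Fin 2 × Fin 2) ℂ :=
  Matrix.of fun p q =>
    if p.1 = q.1 then (if q.1 = 1 then U p.2 q.2 else if p.2 = q.2 then 1 else 0) else 0

theorem controlledMatrix_pauliX_mem :
    controlledMatrix pauliX ∈ Matrix.unitaryGroup (Fin 2 × Fin 2) ℂ := by
  rw [Matrix.mem_unitaryGroup_iff]
  ext ⟨a, b⟩ ⟨c, d⟩
  fin_cases a <;> fin_cases b <;> fin_cases c <;> fin_cases d <;>
    simp [controlledMatrix, pauliX, Matrix.mul_apply, Fintype.sum_prod_type, Fin.sum_univ_two]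

/-- The controlled-not gate `Λ₁(σ_x)`. -/
def cnotGate : TwoBitGate := ⟨controlledMatrix pauliX, controlledMatrix_pauliX_mem⟩

/-- The collection of all rotation gates `U_{θ,φ}` with `0 ≤ θ, φ ≤ 2π`. -/
noncomputable def rotationGates : Set OneBitGate :=
  {A | ∃ θ ∈ Set.Icc (0 : ℝ) (2 * Real.pi), ∃ φ ∈ Set.Icc (0 : ℝ) (2 * Real.pi),
    A = rotationGate θ φ}

/-! The main point is that the composed operators contain the whole special unitary group. A phase
then handles any unitary: multiplying by a suitable root of the inverse determinant makes the
determinant 1.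

Up to three rotations multiply to any element of SU(2), so every slot carries all of SU(2).
Conjugating CNOT by a diagonal gate D gives controlled squares: D σ_x D* σ_x = D². Commutators of
controlled gates combine their controls, since the commutator collapses to 1 wherever either control
is off. As diagonal squares and conjugation generate SU(2), induction gives SU(2) on a slot
controlled by any pattern of all the other bits (`controlledFun_eq_mem`).

Such a gate acts only on two bit strings differing in one bit (`slotHom_controlledFun_eq_twoLevel`).
Paths of one-bit changes yield SU(2) on any two strings (`ContainsTwoLevel.trans`), and Givens
elimination then produces every special unitary matrix
(`specialUnitaryGroup_le_of_containsTwoLevel`). -/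

open Matrix ComplexConjugate

/-! ### SU(2) and the rotation gates -/

/-- The matrix `(α, -β̄; β, ᾱ)`; it lies in `SU(2)` when `|α|² + |β|² = 1`. -/
def su2 (α β : ℂ) : Matrix (Fin 2) (Fin 2) ℂ := !![α, -conj β; β, conj α]

theorem su2_mul (α β γ δ : ℂ) :
    su2 α β * su2 γ δ = su2 (α * γ - conj β * δ) (β * γ + conj α * δ) := by
  ext i j
  fin_cases i <;> fin_cases j <;>
    simp [su2, Matrix.mul_apply, Fin.sum_univ_two] <;> ring

theorem star_su2 (α β : ℂ) : star (su2 α β) = su2 (conj α) (-β) := by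
  ext i j
  fin_cases i <;> fin_cases j <;> simp [su2]

theorem su2_one_zero : su2 1 0 = 1 := by
  ext i j
  fin_cases i <;> fin_cases j <;> simp [su2]

theorem det_su2 (α β : ℂ) : (su2 α β).det = α * conj α + β * conj β := by
  simp [su2, Matrix.det_fin_two]; ring

theorem su2_mem {α β : ℂ} (h : α * conj α + β * conj β = 1) :
    su2 α β ∈ specialUnitaryGroup (Fin 2) ℂ := by
  rw [mem_specialUnitaryGroup_iff, mem_unitaryGroup_iff, star_su2, su2_mul, det_su2]
  refine ⟨?_, h⟩
  rw [← su2_one_zero]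
  congr 1
  · rw [← h]; ring
  · ring

/-- The inverse is the adjugate by determinant 1 and the adjoint by unitarity; comparing entries
determines the second column. -/
theorem exists_eq_su2 {W : Matrix (Fin 2) (Fin 2) ℂ} (hW : W ∈ specialUnitaryGroup (Fin 2) ℂ) :
    ∃ α β : ℂ, α * conj α + β * conj β = 1 ∧ W = su2 α β := by
  obtain ⟨hU, hdet⟩ := mem_specialUnitaryGroup_iff.1 hW
  have hadj : star W = W.adjugate := by
    calc star W = star W * (W * W.adjugate) := by rw [mul_adjugate, hdet, one_smul, mul_one]
      _ = W.adjugate := by rw [← mul_assoc, mem_unitaryGroup_iff'.1 hU, one_mul]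
  rw [adjugate_fin_two] at hadj
  have h00 := congrFun (congrFun hadj 0) 0
  have h01 := congrFun (congrFun hadj 0) 1
  simp at h00 h01
  have hEq : W = su2 (W 0 0) (W 1 0) := by
    ext i j
    fin_cases i <;> fin_cases j <;> simp [su2, h00, h01]
  refine ⟨W 0 0, W 1 0, ?_, hEq⟩
  rw [← det_su2, ← hEq, hdet]

theorem star_mem_specialUnitaryGroup {ι : Type*} [Fintype ι] [DecidableEq ι] {W : Matrix ι ι ℂ}
    (hW : W ∈ specialUnitaryGroup ι ℂ) : star W ∈ specialUnitaryGroup ι ℂ := by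
  rw [mem_specialUnitaryGroup_iff] at hW ⊢
  refine ⟨Unitary.star_mem hW.1, ?_⟩
  rw [star_eq_conjTranspose, det_conjTranspose, hW.2, star_one]

theorem Complex.mul_conj_eq_one {u : ℂ} (hu : ‖u‖ = 1) : u * conj u = 1 := by
  rw [Complex.mul_conj, Complex.normSq_eq_norm_sq, hu]; simp

theorem Complex.exists_norm_eq_one_eq_norm_mul (z : ℂ) : ∃ u : ℂ, ‖u‖ = 1 ∧ z = ‖z‖ * u :=
  ⟨Complex.exp (Complex.arg z * Complex.I), Complex.norm_exp_ofReal_mul_I _,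
    (Complex.norm_mul_exp_arg_mul_I z).symm⟩

theorem Complex.exists_norm_eq_one_sq_eq {u : ℂ} (hu : ‖u‖ = 1) :
    ∃ v : ℂ, ‖v‖ = 1 ∧ v * v = u := by
  obtain ⟨v, hv⟩ := IsAlgClosed.exists_pow_nat_eq u (n := 2) two_pos
  refine ⟨v, ?_, by rw [← hv, sq]⟩
  have h : ‖v‖ ^ 2 = 1 := by rw [← norm_pow, hv, hu]
  exact (pow_eq_one_iff_of_nonneg (norm_nonneg v) two_ne_zero).1 h

/-- A conjugation-invariant submonoid containing the diagonal part of `SU(2)` contains `SU(2)`. -/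
theorem specialUnitaryGroup_two_le_of_conj {N : Submonoid (Matrix (Fin 2) (Fin 2) ℂ)}
    (hconj : ∀ P ∈ specialUnitaryGroup (Fin 2) ℂ, ∀ A ∈ N, P * A * star P ∈ N)
    (hdiag : ∀ u : ℂ, ‖u‖ = 1 → su2 u 0 ∈ N) :
    specialUnitaryGroup (Fin 2) ℂ ≤ N := by
  intro W hW
  obtain ⟨α, β, h, rfl⟩ := exists_eq_su2 hW
  -- Plan: `su2 α β = su2 u 0 * su2 r (u * β)`, and conjugating by a diagonal gate built from a
  -- square root `q` of the phase of `u * β` reduces the second factor to the real rotation `su2 r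
  -- s`.
  obtain ⟨u, hu, hα⟩ := Complex.exists_norm_eq_one_eq_norm_mul α
  obtain ⟨z, hz, hβ⟩ := Complex.exists_norm_eq_one_eq_norm_mul (u * β)
  obtain ⟨q, hq, hqz⟩ := Complex.exists_norm_eq_one_sq_eq hz
  have hu' := Complex.mul_conj_eq_one hu
  have hq' := Complex.mul_conj_eq_one hq
  rw [norm_mul, hu, one_mul] at hβ
  set r : ℝ := ‖α‖
  set s : ℝ := ‖β‖
  have hrs : r ^ 2 + s ^ 2 = 1 := by
    have := h
    rw [Complex.mul_conj, Complex.mul_conj, Complex.normSq_eq_norm_sq,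
      Complex.normSq_eq_norm_sq] at this
    exact_mod_cast this
  have hlam : ‖(r : ℂ) - s * Complex.I‖ = 1 := by
    have h2 : ‖(r : ℂ) - s * Complex.I‖ ^ 2 = 1 := by
      rw [← Complex.normSq_eq_norm_sq, Complex.normSq_apply]
      simp; linarith
    exact (pow_eq_one_iff_of_nonneg (norm_nonneg _) two_ne_zero).1 h2
  have hsqrt : ((√2 / 2 : ℝ) : ℂ) * ((√2 / 2 : ℝ) : ℂ) = 1 / 2 := by
    have : (√2 / 2 : ℝ) * (√2 / 2 : ℝ) = 1 / 2 := by
      have := Real.mul_self_sqrt (zero_le_two (α := ℝ)); nlinarith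
    rw [← Complex.ofReal_mul, this]; norm_num
  set d : ℂ := ((√2 / 2 : ℝ) : ℂ) with hd
  have hdc : conj d = d := Complex.conj_ofReal _
  have hI := Complex.I_mul_I
  -- The real rotation has eigenvector `(1, i)` with eigenvalue `r - s i`; the conjugating matrix
  -- has the normalised eigenvectors as columns.
  have hreal : su2 r s ∈ N := by
    have h1 := hconj (su2 d (Complex.I * d)) (su2_mem (by
      simp only [map_mul, hdc, Complex.conj_I]
      linear_combination (2 : ℂ) * hsqrt - (d * d) * hI)) _ (hdiag _ hlam)
    rw [star_su2, su2_mul, su2_mul] at h1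
    convert h1 using 2
    · simp only [map_mul, map_sub, map_add, hdc, Complex.conj_I, Complex.conj_ofReal, map_zero]
      linear_combination -2 * (r : ℂ) * hsqrt + d * d * (r + s * Complex.I) * hI
    · simp only [map_mul, map_sub, hdc, Complex.conj_I, Complex.conj_ofReal, map_zero]
      linear_combination -2 * (s : ℂ) * hsqrt + 2 * d * d * s * hI
  have hphase : su2 r (u * β) ∈ N := by
    have h1 := hconj (su2 (conj q) 0) (su2_mem (by
      simp only [Complex.conj_conj, map_zero]; linear_combination hq')) _ hreal
    rw [star_su2, su2_mul, su2_mul] at h1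
    convert h1 using 2
    · simp only [map_mul, map_add, Complex.conj_conj, map_zero]
      linear_combination -(r : ℂ) * hq'
    · simp only [map_mul, map_sub, Complex.conj_conj, map_zero]
      rw [hβ, ← hqz]; ring
  have h1 := N.mul_mem (hdiag u hu) hphase
  rw [su2_mul] at h1
  convert h1 using 2
  · rw [hα]; simp; ring
  · linear_combination -β * hu'

/-- Rotation gates exhaust the elements of SU(2) with real diagonal: θ = arccos c makes sin θ = ‖w‖,
and e^{iφ} must be i times the phase of w. -/
theorem exists_rotationMatrix_eq_su2 {c : ℝ} {w : ℂ} (h : c ^ 2 + ‖w‖ ^ 2 = 1) :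
    ∃ θ ∈ Set.Icc (0 : ℝ) (2 * Real.pi), ∃ φ ∈ Set.Icc (0 : ℝ) (2 * Real.pi),
      rotationMatrix θ φ = su2 c w := by
  have hpi := Real.pi_pos
  obtain ⟨z, hz, hw⟩ := Complex.exists_norm_eq_one_eq_norm_mul w
  obtain ⟨φ, hφ, hexp⟩ : ∃ φ ∈ Set.Icc (0 : ℝ) (2 * Real.pi),
      Complex.exp (Complex.I * φ) = Complex.I * z := by
    have hIz : ‖Complex.I * z‖ = 1 := by simp [hz]
    have harg := Complex.norm_mul_exp_arg_mul_I (Complex.I * z)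
    rw [hIz, Complex.ofReal_one, one_mul] at harg
    have hlo := Complex.neg_pi_lt_arg (Complex.I * z)
    have hhi := Complex.arg_le_pi (Complex.I * z)
    by_cases h0 : 0 ≤ Complex.arg (Complex.I * z)
    · exact ⟨_, ⟨h0, by linarith⟩, by rw [mul_comm, harg]⟩
    · refine ⟨Complex.arg (Complex.I * z) + 2 * Real.pi, ⟨by linarith, by linarith⟩, ?_⟩
      push_cast
      rw [mul_add, Complex.exp_add, mul_comm, mul_comm Complex.I (Complex.arg _ : ℂ), harg,
        mul_comm Complex.I, Complex.exp_two_pi_mul_I, one_mul]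
  have hexp' : Complex.exp (-Complex.I * φ) = conj (Complex.I * z) := by
    rw [← hexp, ← Complex.exp_conj]; simp
  have hc1 : -1 ≤ c := by nlinarith [sq_nonneg ‖w‖]
  have hc2 : c ≤ 1 := by nlinarith [sq_nonneg ‖w‖]
  have hcos := Real.cos_arccos hc1 hc2
  have hsin : Real.sin (Real.arccos c) = ‖w‖ := by
    rw [Real.sin_arccos, show 1 - c ^ 2 = ‖w‖ ^ 2 by linarith, Real.sqrt_sq (norm_nonneg w)]
  refine ⟨Real.arccos c, ⟨Real.arccos_nonneg c, by linarith [Real.arccos_le_pi c]⟩, φ, hφ, ?_⟩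
  have hI := Complex.I_mul_I
  have hw' : conj w = ‖w‖ * conj z := by
    conv_lhs => rw [hw]
    simp
  have e1 : -Complex.I * (Complex.I * z) * ‖w‖ = w := by
    linear_combination -(z * ‖w‖) * hI - hw
  have e2 : -Complex.I * conj (Complex.I * z) * ‖w‖ = -conj w := by
    rw [map_mul, Complex.conj_I]
    linear_combination (conj z * ‖w‖) * hI + hw'
  rw [rotationMatrix, su2, hcos, hsin, hexp, hexp', e1, e2, Complex.conj_ofReal]

theorem specialUnitaryGroup_two_le_of_rotationMatrix
    {N : Submonoid (Matrix (Fin 2) (Fin 2) ℂ)}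
    (hrot : ∀ A ∈ rotationGates, (A : Matrix (Fin 2) (Fin 2) ℂ) ∈ N) :
    specialUnitaryGroup (Fin 2) ℂ ≤ N := by
  have hN : ∀ (c : ℝ) (w : ℂ), c ^ 2 + ‖w‖ ^ 2 = 1 → su2 c w ∈ N := by
    intro c w h
    obtain ⟨θ, hθ, φ, hφ, heq⟩ := exists_rotationMatrix_eq_su2 h
    rw [← heq]
    exact hrot (rotationGate θ φ) ⟨θ, hθ, φ, hφ, rfl⟩
  intro W hW
  obtain ⟨α, β, h, rfl⟩ := exists_eq_su2 hW
  obtain ⟨u, hu, hα⟩ := Complex.exists_norm_eq_one_eq_norm_mul α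
  have hu' := Complex.mul_conj_eq_one hu
  have hrs : ‖α‖ ^ 2 + ‖u * β‖ ^ 2 = 1 := by
    rw [norm_mul, hu, one_mul]
    rw [Complex.mul_conj, Complex.mul_conj, Complex.normSq_eq_norm_sq,
      Complex.normSq_eq_norm_sq] at h
    exact_mod_cast h
  -- The first two factors, both with zero diagonal, multiply to `su2 u 0`, which restores the phase
  -- of `α`.
  have h1 := N.mul_mem (N.mul_mem (hN 0 1 (by simp)) (hN 0 (-u) (by simp [hu]))) (hN _ _ hrs)
  rw [su2_mul, su2_mul] at h1
  convert h1 using 2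
  · conv_lhs => rw [hα]
    simp; ring
  · simp; linear_combination -β * hu'

/-! ### Two-level operators generate the special unitary group -/

section TwoLevel

variable {ι : Type*} [DecidableEq ι]

/-- The matrix with columns the basis vectors `a` and `b`. -/
def basisPair (a b : ι) : Matrix ι (Fin 2) ℂ :=
  Matrix.of fun i k => Pi.single (M := fun _ => ℂ) (![a, b] k) 1 i

theorem basisPair_zero (a b i : ι) : basisPair a b i 0 = if i = a then 1 else 0 :=
  Pi.single_apply ..

theorem basisPair_one (a b i : ι) : basisPair a b i 1 = if i = b then 1 else 0 :=
  Pi.single_apply ..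

theorem basisPair_mulVec (a b : ι) (u : Fin 2 → ℂ) (i : ι) :
    (basisPair a b *ᵥ u) i = (if i = a then u 0 else 0) + (if i = b then u 1 else 0) := by
  simp [basisPair_zero, basisPair_one, mulVec, dotProduct, Fin.sum_univ_two]

/-- The operator acting as `W` on the span of the two columns of `P`, and trivially on its
orthogonal complement, when these columns are orthonormal. -/
def twoLevel (P : Matrix ι (Fin 2) ℂ) (W : Matrix (Fin 2) (Fin 2) ℂ) : Matrix ι ι ℂ :=
  1 + P * (W - 1) * Pᴴ

theorem twoLevel_one (P : Matrix ι (Fin 2) ℂ) : twoLevel P 1 = 1 := by simp [twoLevel]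

variable [Fintype ι]

theorem twoLevel_mul {P : Matrix ι (Fin 2) ℂ} (hP : Pᴴ * P = 1) (W W' : Matrix (Fin 2) (Fin 2) ℂ) :
    twoLevel P W * twoLevel P W' = twoLevel P (W * W') := by
  have h : P * (W - 1) * Pᴴ * (P * (W' - 1) * Pᴴ) = P * ((W - 1) * (W' - 1)) * Pᴴ := by
    calc _ = P * (W - 1) * (Pᴴ * P) * (W' - 1) * Pᴴ := by simp only [Matrix.mul_assoc]
      _ = _ := by rw [hP, Matrix.mul_one]; simp only [Matrix.mul_assoc]
  have h2 : W * W' - 1 = (W - 1) + (W' - 1) + (W - 1) * (W' - 1) := by noncomm_ring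
  simp only [twoLevel]
  rw [add_mul, mul_add, mul_add, h, h2, Matrix.mul_add, Matrix.mul_add, Matrix.add_mul,
    Matrix.add_mul, one_mul, mul_one, one_mul]
  abel

theorem star_twoLevel (P : Matrix ι (Fin 2) ℂ) (W : Matrix (Fin 2) (Fin 2) ℂ) :
    star (twoLevel P W) = twoLevel P (star W) := by
  simp [twoLevel, star_eq_conjTranspose, Matrix.mul_assoc]

theorem twoLevel_mem {P : Matrix ι (Fin 2) ℂ} (hP : Pᴴ * P = 1) {W : Matrix (Fin 2) (Fin 2) ℂ}
    (hW : W ∈ specialUnitaryGroup (Fin 2) ℂ) : twoLevel P W ∈ specialUnitaryGroup ι ℂ := by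
  rw [mem_specialUnitaryGroup_iff] at hW ⊢
  constructor
  · rw [mem_unitaryGroup_iff, star_twoLevel, twoLevel_mul hP, mem_unitaryGroup_iff.1 hW.1,
      twoLevel_one]
  -- det(1 + AB) = det(1 + BA) reduces the determinant to that of `W`.
  · rw [twoLevel, Matrix.mul_assoc, det_one_add_mul_comm, Matrix.mul_assoc, hP, Matrix.mul_one,
      add_sub_cancel, hW.2]

theorem conj_twoLevel {U : Matrix ι ι ℂ} (hU : U ∈ unitaryGroup ι ℂ) (P : Matrix ι (Fin 2) ℂ)
    (W : Matrix (Fin 2) (Fin 2) ℂ) : U * twoLevel P W * star U = twoLevel (U * P) W := by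
  rw [twoLevel, mul_add, add_mul, mul_one, mem_unitaryGroup_iff.1 hU, twoLevel,
    conjTranspose_mul, star_eq_conjTranspose]
  simp only [Matrix.mul_assoc]

theorem conjTranspose_basisPair_mulVec (a b : ι) (v : ι → ℂ) :
    (basisPair a b)ᴴ *ᵥ v = ![v a, v b] := by
  ext k
  fin_cases k <;>
    simp [basisPair_zero, basisPair_one, mulVec, dotProduct, apply_ite (starRingEnd ℂ)]

theorem conjTranspose_basisPair_mul {a b : ι} (h : a ≠ b) :
    (basisPair a b)ᴴ * basisPair a b = 1 := by
  ext k l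
  fin_cases k <;> fin_cases l <;> 
    simp [basisPair_zero, basisPair_one, Matrix.mul_apply, apply_ite (starRingEnd ℂ), h, h.symm]

theorem twoLevel_basisPair_mulVec (a b : ι) (W : Matrix (Fin 2) (Fin 2) ℂ) (v : ι → ℂ) (i : ι) :
    (twoLevel (basisPair a b) W *ᵥ v) i = v i +
      ((if i = a then (W *ᵥ ![v a, v b]) 0 - v a else 0) +
        (if i = b then (W *ᵥ ![v a, v b]) 1 - v b else 0)) := by
  rw [twoLevel, add_mulVec, one_mulVec, ← mulVec_mulVec, conjTranspose_basisPair_mulVec,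
    ← mulVec_mulVec, Pi.add_apply, basisPair_mulVec, sub_mulVec, one_mulVec]
  simp

theorem twoLevel_basisPair_mulVec_of_ne {a b i : ι} (hia : i ≠ a) (hib : i ≠ b)
    (W : Matrix (Fin 2) (Fin 2) ℂ) (v : ι → ℂ) :
    (twoLevel (basisPair a b) W *ᵥ v) i = v i := by
  simp [twoLevel_basisPair_mulVec, hia, hib]

theorem twoLevel_basisPair_mulVec_left {a b : ι} (h : a ≠ b)
    (W : Matrix (Fin 2) (Fin 2) ℂ) (v : ι → ℂ) :
    (twoLevel (basisPair a b) W *ᵥ v) a = (W *ᵥ ![v a, v b]) 0 := by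
  simp [twoLevel_basisPair_mulVec, h]

theorem twoLevel_basisPair_mulVec_right {a b : ι} (h : a ≠ b)
    (W : Matrix (Fin 2) (Fin 2) ℂ) (v : ι → ℂ) :
    (twoLevel (basisPair a b) W *ᵥ v) b = (W *ᵥ ![v a, v b]) 1 := by
  simp [twoLevel_basisPair_mulVec, h.symm]

theorem twoLevel_basisPair_mulVec_single {a b i : ι} (hia : i ≠ a) (hib : i ≠ b)
    (W : Matrix (Fin 2) (Fin 2) ℂ) :
    twoLevel (basisPair a b) W *ᵥ Pi.single i 1 = Pi.single i 1 := by
  ext j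
  simp [twoLevel_basisPair_mulVec, hia.symm, hib.symm]

/-- A submonoid contains the whole of `SU(2)` acting on the basis vectors `a` and `b`. -/
def ContainsTwoLevel (G : Submonoid (Matrix ι ι ℂ)) (a b : ι) : Prop :=
  ∀ W ∈ specialUnitaryGroup (Fin 2) ℂ, twoLevel (basisPair a b) W ∈ G

/-- The quarter turn on `a, b` sends `b` to `-a` and fixes `c`, so conjugation by it moves a gate
from `b, c` to `a, c`. The sign is compensated by replacing `β` with `-β`. -/
theorem ContainsTwoLevel.trans {G : Submonoid (Matrix ι ι ℂ)} {a b c : ι} (hab : a ≠ b)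
    (hac : a ≠ c) (hbc : b ≠ c) (h1 : ContainsTwoLevel G a b) (h2 : ContainsTwoLevel G b c) :
    ContainsTwoLevel G a c := by
  intro W hW
  have hJ : su2 0 1 ∈ specialUnitaryGroup (Fin 2) ℂ := su2_mem (by simp)
  obtain ⟨α, β, hαβ, rfl⟩ := exists_eq_su2 hW
  have hU := (mem_specialUnitaryGroup_iff.1 (twoLevel_mem (conjTranspose_basisPair_mul hab) hJ)).1
  have hmem := G.mul_mem (G.mul_mem (h1 _ hJ) (h2 (su2 α (-β)) (su2_mem (by simpa using hαβ))))
    (h1 _ (star_mem_specialUnitaryGroup hJ))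
  rw [← star_twoLevel, conj_twoLevel hU] at hmem
  convert hmem using 1
  have hcols : twoLevel (basisPair a b) (su2 0 1) * basisPair b c =
      basisPair a c * (!![-1, 0; 0, 1] : Matrix (Fin 2) (Fin 2) ℂ) := by
    ext i k
    have hcol : ∀ k, (basisPair b c).col k = Pi.single (![b, c] k) 1 := by
      intro k; rfl
    change (twoLevel (basisPair a b) (su2 0 1) *ᵥ (basisPair b c).col k) i = _
    rw [hcol, twoLevel_basisPair_mulVec]
    fin_cases k
    · simp [su2, basisPair_zero, basisPair_one, Matrix.mul_apply, Pi.single_apply, hab]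
      split_ifs <;> simp_all
    · simp [su2, basisPair_zero, basisPair_one, Matrix.mul_apply, Pi.single_apply, hac, hbc]
  rw [hcols, twoLevel, twoLevel, conjTranspose_mul]
  congr 1
  have hD : su2 α β - 1 = !![-1, 0; 0, 1] * (su2 α (-β) - 1) * (!![-1, 0; 0, 1])ᴴ := by
    have hstar : (!![-1, 0; 0, 1] : Matrix (Fin 2) (Fin 2) ℂ)ᴴ = !![-1, 0; 0, 1] := by
      ext i j
      fin_cases i <;> fin_cases j <;> simp
    rw [hstar]
    ext i j
    fin_cases i <;> fin_cases j <;> simp [su2, one_fin_two]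
  rw [hD]
  simp only [Matrix.mul_assoc]

theorem exists_specialUnitaryGroup_mulVec_eq (x y : ℂ) :
    ∃ W ∈ specialUnitaryGroup (Fin 2) ℂ, ∃ r : ℝ, 0 ≤ r ∧ W *ᵥ ![x, y] = ![(r : ℂ), 0] := by
  set r : ℝ := √(‖x‖ ^ 2 + ‖y‖ ^ 2) with hr
  have hsq : r ^ 2 = ‖x‖ ^ 2 + ‖y‖ ^ 2 := Real.sq_sqrt (by positivity)
  by_cases h0 : r = 0
  · rw [h0] at hsq
    have hx : x = 0 := norm_eq_zero.1 (by nlinarith [sq_nonneg ‖x‖, sq_nonneg ‖y‖])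
    have hy : y = 0 := norm_eq_zero.1 (by nlinarith [sq_nonneg ‖x‖, sq_nonneg ‖y‖])
    exact ⟨1, one_mem _, 0, le_rfl, by simp [hx, hy]⟩
  · have hr0 : (r : ℂ) ≠ 0 := by exact_mod_cast h0
    have hsq' : (r : ℂ) ^ 2 = x * conj x + y * conj y := by
      rw [Complex.mul_conj, Complex.mul_conj, Complex.normSq_eq_norm_sq,
        Complex.normSq_eq_norm_sq]
      exact_mod_cast hsq
    -- The first row is the conjugate of the unit vector `(x, y) / r`; the second row is orthogonal
    -- to `(x, y)`.
    refine ⟨su2 (conj x / r) (-y / r), su2_mem ?_, r, Real.sqrt_nonneg _, ?_⟩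
    · simp only [map_div₀, map_neg, Complex.conj_conj, Complex.conj_ofReal]
      field_simp
      rw [hsq']; ring
    · ext k
      fin_cases k
      · simp [su2]
        field_simp
        rw [hsq']
      · simp [su2]
        ring

/-- Givens elimination: each entry indexed by `t` is rotated into entry `a`. Membership is stated
for `star g` because `G` is only a submonoid and `V` will be recovered as `star g * (g * V)`. For
empty `t` no rotation occurs, so nothing makes entry `a` nonnegative. -/
theorem exists_mulVec_eliminate {G : Submonoid (Matrix ι ι ℂ)}
    (hG : ∀ a b, a ≠ b → ContainsTwoLevel G a b) (a : ι) (v : ι → ℂ) (t : Finset ι) (hat : a ∉ t) :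
    ∃ g ∈ specialUnitaryGroup ι ℂ, star g ∈ G ∧
      (∀ i, i ≠ a → i ∉ t → g *ᵥ Pi.single i 1 = Pi.single i 1) ∧
      (∀ i ∈ t, (g *ᵥ v) i = 0) ∧
      (t.Nonempty → ∃ r : ℝ, 0 ≤ r ∧ (g *ᵥ v) a = r) := by
  induction t using Finset.induction_on with
  | empty => exact ⟨1, one_mem _, by simp, fun i _ _ => one_mulVec _, by simp, by simp⟩
  | insert b t hbt ih =>
    rw [Finset.mem_insert, not_or] at hat
    obtain ⟨hab, hat⟩ := hat
    obtain ⟨g, hgS, hgG, hfix, hzero, -⟩ := ih hat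
    obtain ⟨W, hW, r, hr, hWr⟩ := exists_specialUnitaryGroup_mulVec_eq ((g *ᵥ v) a) ((g *ᵥ v) b)
    refine ⟨twoLevel (basisPair a b) W * g,
      mul_mem (twoLevel_mem (conjTranspose_basisPair_mul hab) hW) hgS, ?_, ?_, ?_, ?_⟩
    · rw [star_mul, star_twoLevel]
      exact mul_mem hgG (hG a b hab _ (star_mem_specialUnitaryGroup hW))
    · intro i hia hi
      rw [Finset.mem_insert, not_or] at hi
      rw [← mulVec_mulVec, hfix i hia hi.2, twoLevel_basisPair_mulVec_single hia hi.1]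
    · intro i hi
      rw [← mulVec_mulVec]
      rcases Finset.mem_insert.1 hi with rfl | hit
      · rw [twoLevel_basisPair_mulVec_right hab, hWr]; rfl
      · rw [twoLevel_basisPair_mulVec_of_ne (by rintro rfl; exact hat hit)
          (by rintro rfl; exact hbt hit), hzero i hit]
    · intro _
      refine ⟨r, hr, ?_⟩
      rw [← mulVec_mulVec, twoLevel_basisPair_mulVec_left hab, hWr]; rfl

/-- The adjoint fixes the same basis vector, so row `i` also vanishes off the diagonal. -/
theorem mulVec_single_apply_of_fixed {V : Matrix ι ι ℂ} (hV : V ∈ unitaryGroup ι ℂ) {i j : ι}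
    (hi : V *ᵥ Pi.single i 1 = Pi.single i 1) (hij : i ≠ j) : V i j = 0 := by
  have hstar : star V *ᵥ Pi.single i 1 = Pi.single i 1 := by
    conv_lhs => rw [← hi]
    rw [mulVec_mulVec, mem_unitaryGroup_iff'.1 hV, one_mulVec]
  have h := congrFun hstar j
  rw [mulVec_single_one] at h
  simpa [hij.symm, star_eq_conjTranspose] using h

/-- The two-level special unitaries generate the special unitary group. -/
theorem specialUnitaryGroup_le_of_containsTwoLevel {G : Submonoid (Matrix ι ι ℂ)}
    (hG : ∀ a b, a ≠ b → ContainsTwoLevel G a b) : specialUnitaryGroup ι ℂ ≤ G := by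
  -- Induction on a set of basis vectors outside which `V` fixes every basis vector.
  suffices h : ∀ s : Finset ι, ∀ V ∈ specialUnitaryGroup ι ℂ,
      (∀ i ∉ s, V *ᵥ Pi.single i 1 = Pi.single i 1) → V ∈ G from
    fun V hV => h Finset.univ V hV (by simp)
  intro s
  induction s using Finset.induction_on with
  | empty =>
    intro V _ hfix
    have : V = 1 := by
      ext i j
      have := congrFun (hfix j (by simp)) i
      rw [mulVec_single_one] at this
      simpa [Matrix.one_apply, Pi.single_apply] using this
    rw [this]
    exact one_mem G
  | insert a t hat ih =>
    intro V hV hfix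
    obtain ⟨g, hgS, hgG, hgfix, hzero, hpos⟩ :=
      exists_mulVec_eliminate hG a (V *ᵥ Pi.single a 1) t hat
    have hgV : g * V ∈ specialUnitaryGroup ι ℂ := mul_mem hgS hV
    obtain ⟨hU, hdet⟩ := mem_specialUnitaryGroup_iff.1 hgV
    have hgVfix : ∀ i ∉ insert a t, (g * V) *ᵥ Pi.single i 1 = Pi.single i 1 := by
      intro i hi
      rw [← mulVec_mulVec, hfix i hi]
      rw [Finset.mem_insert, not_or] at hi
      exact hgfix i hi.1 hi.2
    have hcol : ∀ i, i ≠ a → (g * V) i a = 0 := by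
      intro i hia
      by_cases hi : i ∈ t
      · have := hzero i hi
        rw [mulVec_mulVec, mulVec_single_one] at this
        exact this
      · exact mulVec_single_apply_of_fixed hU (hgVfix i (by simp [hia, hi])) hia
    -- If `t` is empty, the matrix is diagonal with all other entries 1, so the determinant decides.
    -- Otherwise the entry is nonnegative and has modulus 1.
    have hdiag : (g * V) a a = 1 := by
      rcases t.eq_empty_or_nonempty with rfl | hne
      · have hD : g * V = diagonal fun i => (g * V) i i := by
          ext i j
          by_cases hij : i = j
          · simp [hij]
          · rw [diagonal_apply_ne _ hij]
            by_cases hja : j = a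
            · subst hja; exact hcol i hij
            · have := congrFun (hgVfix j (by simp [hja])) i
              rw [mulVec_single_one] at this
              simpa [hij] using this
        rw [hD, det_diagonal, Finset.prod_eq_single a] at hdet
        · exact hdet
        · intro j _ hja
          have := congrFun (hgVfix j (by simp [hja])) j
          rw [mulVec_single_one] at this
          simpa using this
        · simp
      · obtain ⟨r, hr, hra⟩ := hpos hne
        rw [mulVec_mulVec, mulVec_single_one] at hra
        change (g * V) a a = r at hra
        have h1 := congrFun (congrFun (mem_unitaryGroup_iff'.1 hU) a) a
        rw [Matrix.mul_apply, Finset.sum_eq_single a, one_apply_eq, star_apply, hra] at h1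
        · have h2 : r * r = 1 := by
            have : (r : ℂ) * r = 1 := by simpa using h1
            exact_mod_cast this
          have h3 : r = 1 := by nlinarith
          rw [hra, h3, Complex.ofReal_one]
        · intro j _ hja
          rw [hcol j hja, mul_zero]
        · simp
    have hmem : g * V ∈ G := by
      refine ih _ hgV fun i hi => ?_
      by_cases hia : i = a
      · subst hia
        ext j
        rw [mulVec_single_one]
        change (g * V) j i = _
        by_cases hji : j = i
        · subst hji; simpa using hdiag
        · simp [hcol j hji, hji]
      · exact hgVfix i (by simp [hia, hi])
    have hVeq : V = star g * (g * V) := by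
      rw [← mul_assoc, mem_unitaryGroup_iff'.1 (mem_specialUnitaryGroup_iff.1 hgS).1, one_mul]
    rw [hVeq]
    exact mul_mem hgG hmem

end TwoLevel

/-! ### Controlled gates from commutators -/

section Controlled

variable {κ : Type*}

/-- The matrix-valued function with value `W` where `p` holds, and `1` elsewhere: the gate `W`
controlled by the predicate `p` on the bits `κ`. -/
def controlledFun (p : (κ → Fin 2) → Prop) [DecidablePred p] (W : Matrix (Fin 2) (Fin 2) ℂ) :
    (κ → Fin 2) → Matrix (Fin 2) (Fin 2) ℂ :=
  fun x => if p x then W else 1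

theorem controlledFun_one (p : (κ → Fin 2) → Prop) [DecidablePred p] : controlledFun p 1 = 1 := by
  ext x : 1
  simp [controlledFun]

theorem controlledFun_mul (p : (κ → Fin 2) → Prop) [DecidablePred p]
    (W W' : Matrix (Fin 2) (Fin 2) ℂ) :
    controlledFun p W * controlledFun p W' = controlledFun p (W * W') := by
  ext x : 1
  by_cases h : p x <;> simp [controlledFun, h]

/-- The gates whose controlled version lies in `Γ`. -/
def controlledSubmonoid (Γ : Submonoid ((κ → Fin 2) → Matrix (Fin 2) (Fin 2) ℂ))
    (p : (κ → Fin 2) → Prop) [DecidablePred p] : Submonoid (Matrix (Fin 2) (Fin 2) ℂ) where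
  carrier := {W | controlledFun p W ∈ Γ}
  one_mem' := by
    change controlledFun p 1 ∈ Γ
    rw [controlledFun_one]
    exact one_mem Γ
  mul_mem' {W W'} h h' := by
    change controlledFun p (W * W') ∈ Γ
    rw [← controlledFun_mul]
    exact mul_mem h h'

theorem mem_controlledSubmonoid {Γ : Submonoid ((κ → Fin 2) → Matrix (Fin 2) (Fin 2) ℂ)}
    {p : (κ → Fin 2) → Prop} {_ : DecidablePred p} {W : Matrix (Fin 2) (Fin 2) ℂ} :
    W ∈ controlledSubmonoid Γ p ↔ controlledFun p W ∈ Γ := Iff.rfl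

variable {Γ : Submonoid ((κ → Fin 2) → Matrix (Fin 2) (Fin 2) ℂ)}

/-- Conjugating by a constant function conjugates the controlled gate and cancels where `p` fails,
so diagonal gates suffice. Squares lose nothing, as every phase has a square root, and they are what
commutators produce. -/
theorem specialUnitaryGroup_le_controlledSubmonoid
    (hconst : ∀ W ∈ specialUnitaryGroup (Fin 2) ℂ, (fun _ => W) ∈ Γ)
    (p : (κ → Fin 2) → Prop) [DecidablePred p]
    (hdiag : ∀ v : ℂ, ‖v‖ = 1 → controlledFun p (su2 (v * v) 0) ∈ Γ) :
    specialUnitaryGroup (Fin 2) ℂ ≤ controlledSubmonoid Γ p := by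
  refine specialUnitaryGroup_two_le_of_conj (fun P hP A hA => ?_) fun u hu => ?_
  · have hmem := mul_mem (mul_mem (hconst P hP) hA) (hconst _ (star_mem_specialUnitaryGroup hP))
    rw [mem_controlledSubmonoid]
    convert hmem using 1
    ext x : 1
    by_cases h : p x
    · simp [controlledFun, h]
    · simp [controlledFun, h, mem_unitaryGroup_iff.1 (mem_specialUnitaryGroup_iff.1 hP).1]
  · obtain ⟨v, hv, rfl⟩ := Complex.exists_norm_eq_one_sq_eq hu
    exact hdiag v hv

theorem su2_mem_of_norm {v : ℂ} (hv : ‖v‖ = 1) : su2 v 0 ∈ specialUnitaryGroup (Fin 2) ℂ :=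
  su2_mem (by simpa using Complex.mul_conj_eq_one hv)

/-- If `p`-controlled and `q`-controlled gates are available, so are `p ∧ q`-controlled ones, since
`SU(2)` is generated by commutators. -/
theorem specialUnitaryGroup_le_controlledSubmonoid_and
    (hconst : ∀ W ∈ specialUnitaryGroup (Fin 2) ℂ, (fun _ => W) ∈ Γ)
    {p q : (κ → Fin 2) → Prop} [DecidablePred p] [DecidablePred q]
    (hp : specialUnitaryGroup (Fin 2) ℂ ≤ controlledSubmonoid Γ p)
    (hq : specialUnitaryGroup (Fin 2) ℂ ≤ controlledSubmonoid Γ q) :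
    specialUnitaryGroup (Fin 2) ℂ ≤ controlledSubmonoid Γ fun x => p x ∧ q x := by
  refine specialUnitaryGroup_le_controlledSubmonoid hconst _ fun v hv => ?_
  have hP := su2_mem_of_norm hv
  have hJ : su2 0 1 ∈ specialUnitaryGroup (Fin 2) ℂ := su2_mem (by simp)
  -- Conjugation by `su2 0 1` inverts diagonal gates, so the commutator is the square of `su2 v 0`.
  have hmem := mul_mem (mul_mem (mul_mem (mem_controlledSubmonoid.1 (hp hP))
    (mem_controlledSubmonoid.1 (hq hJ)))
    (mem_controlledSubmonoid.1 (hp (star_mem_specialUnitaryGroup hP))))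
    (mem_controlledSubmonoid.1 (hq (star_mem_specialUnitaryGroup hJ)))
  have hPP := mem_unitaryGroup_iff.1 (mem_specialUnitaryGroup_iff.1 hP).1
  have hJJ := mem_unitaryGroup_iff.1 (mem_specialUnitaryGroup_iff.1 hJ).1
  convert hmem using 1
  ext x : 1
  by_cases h : p x <;> by_cases h' : q x
  · simp [controlledFun, h, h', star_su2, su2_mul]
  · simp [controlledFun, h, h', hPP]
  · simp [controlledFun, h, h', hJJ]
  · simp [controlledFun, h, h']

/-- For control value 1, σ_x inverts diagonal gates, so D σ_x D* σ_x is D² when the control is on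
and 1 otherwise. For control value 0, an uncontrolled `W` is undone where the bit is 1. -/
theorem specialUnitaryGroup_le_controlledSubmonoid_eq
    (hconst : ∀ W ∈ specialUnitaryGroup (Fin 2) ℂ, (fun _ => W) ∈ Γ)
    (hnot : ∀ c : κ, controlledFun (fun x => x c = 1) pauliX ∈ Γ) (c : κ) (b : Fin 2) :
    specialUnitaryGroup (Fin 2) ℂ ≤ controlledSubmonoid Γ fun x => x c = b := by
  have hone : specialUnitaryGroup (Fin 2) ℂ ≤ controlledSubmonoid Γ fun x => x c = 1 := by
    refine specialUnitaryGroup_le_controlledSubmonoid hconst _ fun v hv => ?_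
    have hP := su2_mem_of_norm hv
    have hmem := mul_mem (mul_mem (mul_mem (hconst _ hP) (hnot c))
      (hconst _ (star_mem_specialUnitaryGroup hP))) (hnot c)
    convert hmem using 1
    ext x : 1
    by_cases h : x c = 1
    · simp only [controlledFun, h, if_true, Pi.mul_apply, star_su2]
      ext i j
      fin_cases i <;> fin_cases j <;> simp [su2, pauliX, Matrix.mul_apply]
    · simp [controlledFun, h, mem_unitaryGroup_iff.1 (mem_specialUnitaryGroup_iff.1 hP).1]
  match b with
  | 1 => exact hone
  | 0 =>
    intro W hW
    have hmem := mul_mem (hconst W hW)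
      (mem_controlledSubmonoid.1 (hone (star_mem_specialUnitaryGroup hW)))
    rw [mem_controlledSubmonoid]
    convert hmem using 1
    ext x : 1
    by_cases h : x c = 0
    · simp [controlledFun, h]
    · have h1 : x c = 1 := by omega
      simp [controlledFun, h1, mem_unitaryGroup_iff.1 (mem_specialUnitaryGroup_iff.1 hW).1]

theorem specialUnitaryGroup_le_controlledSubmonoid_forall [DecidableEq κ]
    (hconst : ∀ W ∈ specialUnitaryGroup (Fin 2) ℂ, (fun _ => W) ∈ Γ)
    (hnot : ∀ c : κ, controlledFun (fun x => x c = 1) pauliX ∈ Γ) (a : κ → Fin 2)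
    (s : Finset κ) :
    specialUnitaryGroup (Fin 2) ℂ ≤ controlledSubmonoid Γ fun x => ∀ c ∈ s, x c = a c := by
  induction s using Finset.induction_on with
  | empty =>
    intro W hW
    rw [mem_controlledSubmonoid]
    convert hconst W hW using 1
    ext x : 1
    simp [controlledFun]
  | insert c s _ ih =>
    convert specialUnitaryGroup_le_controlledSubmonoid_and hconst
      (specialUnitaryGroup_le_controlledSubmonoid_eq hconst hnot c (a c)) ih using 4
    rw [Finset.forall_mem_insert]

theorem controlledFun_eq_mem [Fintype κ] [DecidableEq κ]
    (hconst : ∀ W ∈ specialUnitaryGroup (Fin 2) ℂ, (fun _ => W) ∈ Γ)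
    (hnot : ∀ c : κ, controlledFun (fun x => x c = 1) pauliX ∈ Γ) (a : κ → Fin 2)
    {W : Matrix (Fin 2) (Fin 2) ℂ} (hW : W ∈ specialUnitaryGroup (Fin 2) ℂ) :
    controlledFun (fun x => x = a) W ∈ Γ := by
  have h := specialUnitaryGroup_le_controlledSubmonoid_forall hconst hnot a Finset.univ hW
  rw [mem_controlledSubmonoid] at h
  convert h using 1
  ext x : 1
  simp [controlledFun, funext_iff]

end Controlled

/-! ### Operators on one slot as block-diagonal matrices -/

section Slot

variable {n : ℕ}

/-- The operator on `n` qubits acting on slot `t` by the matrix `F x`, where `x` is the string of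
the other bits. -/
def slotHom (t : Fin n) :
    (({i // i ≠ t} → Fin 2) → Matrix (Fin 2) (Fin 2) ℂ) →* QubitOperator n where
  toFun F := (blockDiagonal F).submatrix (Equiv.funSplitAt t (Fin 2)) (Equiv.funSplitAt t (Fin 2))
  map_one' := by rw [blockDiagonal_one, submatrix_one_equiv]
  map_mul' F F' := by
    rw [submatrix_mul_equiv, ← blockDiagonal_mul]
    rfl

theorem slotHom_apply (t : Fin n) (F : ({i // i ≠ t} → Fin 2) → Matrix (Fin 2) (Fin 2) ℂ)
    (x y : Fin n → Fin 2) :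
    slotHom t F x y =
      if ∀ i, i ≠ t → x i = y i then F (fun i => x i) (x t) (y t) else 0 := by
  change blockDiagonal F (Equiv.funSplitAt t (Fin 2) x) (Equiv.funSplitAt t (Fin 2) y) = _
  rw [blockDiagonal_apply]
  simp [funext_iff]

theorem OneBitGate.onSlot_eq_slotHom (A : OneBitGate) (t : Fin n) :
    A.onSlot t = slotHom t fun _ => (A : Matrix (Fin 2) (Fin 2) ℂ) := by
  ext x y
  rw [slotHom_apply]
  rfl

theorem cnotGate_onSlots_eq_slotHom {c t : Fin n} (h : c ≠ t) :
    TwoBitGate.onSlots cnotGate c t =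
      slotHom t (controlledFun (fun x => x ⟨c, h⟩ = 1) pauliX) := by
  ext x y
  rw [slotHom_apply]
  simp only [TwoBitGate.onSlots, cnotGate, controlledMatrix, controlledFun, of_apply]
  by_cases hc : x c = y c
  · have hiff : (∀ i, i ≠ c → i ≠ t → x i = y i) ↔ ∀ i, i ≠ t → x i = y i :=
      ⟨fun H i hi => if hic : i = c then hic ▸ hc else H i hic hi, fun H i _ hi => H i hi⟩
    simp only [hiff, hc, if_true]
    split_ifs <;> simp_all [Matrix.one_apply]
  · rw [if_neg fun H : ∀ i, i ≠ t → x i = y i => hc (H c h)]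
    simp [hc]

/-- Once all other bits are prescribed by `a`, only the value of bit `t` remains free, leaving two
basis vectors. -/
theorem slotHom_controlledFun_eq_twoLevel (t : Fin n) (a : Fin n → Fin 2)
    (W : Matrix (Fin 2) (Fin 2) ℂ) :
    slotHom t (controlledFun (fun x => x = fun i : {i // i ≠ t} => a i) W) =
      twoLevel (basisPair (Function.update a t 0) (Function.update a t 1)) W := by
  ext x y
  have key : ∀ (z : Fin n → Fin 2) (b : Fin 2),
      z = Function.update a t b ↔ (∀ i, i ≠ t → z i = a i) ∧ z t = b := by
    intro z b
    rw [Function.eq_update_iff]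
    exact and_comm
  have hxy : x = y ↔ (∀ i, i ≠ t → x i = y i) ∧ x t = y t := by
    constructor
    · rintro rfl; simp
    · rintro ⟨h1, h2⟩
      ext i
      by_cases hi : i = t
      · rw [hi, h2]
      · rw [h1 i hi]
  rw [slotHom_apply]
  simp only [controlledFun, twoLevel, basisPair_zero, basisPair_one, Matrix.add_apply,
    Matrix.mul_apply,
    Fin.sum_univ_two, conjTranspose_apply, key, funext_iff, Subtype.forall, Matrix.sub_apply]
  rw [Matrix.one_apply (i := x)]
  simp only [hxy]
  by_cases hx : ∀ i, i ≠ t → x i = a i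
  · by_cases hy : ∀ i, i ≠ t → y i = a i
    · have h : ∀ i, i ≠ t → x i = y i := fun i hi => (hx i hi).trans (hy i hi).symm
      rw [if_pos h, if_pos hx]
      simp only [eq_true hx, eq_true hy, eq_true h, true_and]
      generalize x t = k
      generalize y t = l
      fin_cases k <;> fin_cases l <;> simp
    · have h : ¬ ∀ i, i ≠ t → x i = y i := fun h =>
        hy fun i hi => (h i hi).symm.trans (hx i hi)
      simp [eq_false h, eq_false hy]
  · simp only [eq_false hx, false_and, if_false]
    by_cases h : ∀ i, i ≠ t → x i = y i
    · simp [eq_true h, Matrix.one_apply]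
    · simp [eq_false h]

end Slot

/-! ### From one-bit changes to all special unitaries, and the global phase -/

theorem containsTwoLevel_update {n : ℕ} {G : Submonoid (QubitOperator n)}
    (hrot : ∀ A ∈ rotationGates, ∀ t : Fin n, A.onSlot t ∈ G)
    (hnot : ∀ c t : Fin n, c ≠ t → TwoBitGate.onSlots cnotGate c t ∈ G)
    (a : Fin n → Fin 2) (t : Fin n) :
    ContainsTwoLevel G (Function.update a t 0) (Function.update a t 1) := by
  intro W hW
  rw [← slotHom_controlledFun_eq_twoLevel]
  refine controlledFun_eq_mem (Γ := G.comap (slotHom t)) ?_ ?_ _ hW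
  · have hle := specialUnitaryGroup_two_le_of_rotationMatrix
      (N := (G.comap (slotHom t)).comap (Pi.constMonoidHom _ _)) fun A hA => by
        have := hrot A hA t
        rwa [OneBitGate.onSlot_eq_slotHom] at this
    exact fun W hW => hle hW
  · rintro ⟨c, hc⟩
    rw [Submonoid.mem_comap, ← cnotGate_onSlots_eq_slotHom hc]
    exact hnot c t hc

/-- Exchanging the basis vectors conjugates `W` by σ_x, which preserves SU(2). -/
theorem ContainsTwoLevel.symm {ι : Type*} [Fintype ι] [DecidableEq ι]
    {G : Submonoid (Matrix ι ι ℂ)} {a b : ι} (h : ContainsTwoLevel G a b) :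
    ContainsTwoLevel G b a := by
  intro W hW
  obtain ⟨α, β, hαβ, rfl⟩ := exists_eq_su2 hW
  convert h (su2 (conj α) (-conj β)) (su2_mem (by simpa [mul_comm] using hαβ)) using 1
  ext i j
  simp [twoLevel, basisPair_zero, basisPair_one, su2, Matrix.mul_apply, Fin.sum_univ_two]
  ring_nf

/-- Any two bit strings are joined by changing one bit at a time. -/
theorem containsTwoLevel_of_update {n : ℕ} {G : Submonoid (QubitOperator n)}
    (hG : ∀ (a : Fin n → Fin 2) (t : Fin n),
      ContainsTwoLevel G (Function.update a t 0) (Function.update a t 1))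
    (a b : Fin n → Fin 2) (hab : a ≠ b) : ContainsTwoLevel G a b := by
  have hstep : ∀ (a : Fin n → Fin 2) (t : Fin n) (k : Fin 2), k ≠ a t →
      ContainsTwoLevel G a (Function.update a t k) := by
    intro a t k hk
    have h := hG a t
    rcases (by omega : (a t = 0 ∧ k = 1) ∨ (a t = 1 ∧ k = 0)) with ⟨h1, rfl⟩ | ⟨h1, rfl⟩
    · rwa [← h1, Function.update_eq_self] at h
    · rw [← h1, Function.update_eq_self] at h
      exact h.symm
  -- The path runs through the strings agreeing with `b` on `s` and with `a` elsewhere. While it has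
  -- not left `a`, transitivity does not apply and the single step is used directly.
  have hpath : ∀ s : Finset (Fin n), a ≠ s.piecewise b a →
      ContainsTwoLevel G a (s.piecewise b a) := by
    intro s
    induction s using Finset.induction_on with
    | empty => simp
    | insert t s hts ih =>
      rw [Finset.piecewise_insert]
      intro hne
      set c := s.piecewise b a
      by_cases hbc : b t = c t
      · rw [hbc, Function.update_eq_self] at hne ⊢
        exact ih hne
      · have hc := hstep c t (b t) hbc
        by_cases hac : a = c
        · rwa [← hac] at hc ⊢
        · refine (ih hac).trans hac hne ?_ hc
          intro h
          exact hbc (by rw [h]; simp)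
  simpa using hpath Finset.univ (by simpa using hab)

theorem specialUnitaryGroup_le_composedOperators (n : ℕ) :
    specialUnitaryGroup (Fin n → Fin 2) ℂ ≤ composedOperators rotationGates {cnotGate} n :=
  specialUnitaryGroup_le_of_containsTwoLevel <| containsTwoLevel_of_update <|
    containsTwoLevel_update
      (fun A hA t => Submonoid.subset_closure (Or.inl ⟨A, hA, t, rfl⟩))
      (fun c t h => Submonoid.subset_closure (Or.inr ⟨cnotGate, rfl, c, t, h, rfl⟩))

theorem exists_smul_mem_specialUnitaryGroup {ι : Type*} [Fintype ι] [DecidableEq ι] [Nonempty ι]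
    {V : Matrix ι ι ℂ} (hV : V ∈ unitaryGroup ι ℂ) :
    ∃ c : ℂ, ‖c‖ = 1 ∧ c • V ∈ specialUnitaryGroup ι ℂ := by
  have hd : ‖V.det‖ = 1 := CStarRing.norm_of_mem_unitary (det_of_mem_unitary hV)
  have hd0 : V.det ≠ 0 := norm_ne_zero_iff.1 (by rw [hd]; exact one_ne_zero)
  -- Scaling by `c` multiplies the determinant by `c` to the power of the dimension.
  obtain ⟨c, hc⟩ := IsAlgClosed.exists_pow_nat_eq V.det⁻¹ (Fintype.card_pos (α := ι))
  have hcn : ‖c‖ = 1 := by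
    refine (pow_eq_one_iff_of_nonneg (norm_nonneg c) (Fintype.card_ne_zero (α := ι))).1 ?_
    rw [← norm_pow, hc, norm_inv, hd, inv_one]
  refine ⟨c, hcn, mem_specialUnitaryGroup_iff.2 ⟨?_, ?_⟩⟩
  · rw [mem_unitaryGroup_iff, star_smul, smul_mul_smul_comm, mem_unitaryGroup_iff.1 hV]
    have := Complex.mul_conj_eq_one hcn
    rw [starRingEnd_apply] at this
    rw [this, one_smul]
  · rw [det_smul, hc, inv_mul_cancel₀ hd0]

/-- The rotation gates and the CNOT gate are universal; moreover no phase factor is needed for the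
`n`-bit gates of determinant one. -/
theorem corollary2p3 :
    IsUniversalGateSet rotationGates {cnotGate} ∧
      ∀ n : ℕ, 2 ≤ n → ∀ V ∈ Matrix.specialUnitaryGroup (Fin n → Fin 2) ℂ,
        V ∈ composedOperators rotationGates {cnotGate} n :=
  ⟨fun n _ _ hV =>
    let ⟨c, hc, hmem⟩ := exists_smul_mem_specialUnitaryGroup hV
    ⟨c, hc, specialUnitaryGroup_le_composedOperators n hmem⟩,
  fun n _ _ hV => specialUnitaryGroup_le_composedOperators n hV⟩
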